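/- **Setting.** A simplicial complex $\hat\Sigma$ on a (discrete, possibly infinite) vertex set $X$ is a set of finite subsets of $X$ that contains $\varnothing$ and is closed under taking subsets; $\dim\sigma=|\sigma|-1$, and $\dim\hat\Sigma=\sup_{\sigma\in\hat\Sigma}\dim\sigma$. Write $\tau\prec\sigma$ (or $\sigma\succ\tau$) if $\tau\subseteq\sigma$ and $|\sigma\setminus\tau|=1$. Let $m:\hat\Sigma\to(0,\infty)$ be a weight with $\sum_{\sigma\succ\tau}m(\sigma)<\infty$ for every nonempty $\tau\in\hat\Sigma$. Put $\Sigma=\hat\Sigma$ if the total weight $\sum_{\sigma\succ\varnothing}m(\sigma)$ of the vertices is finite, and $\Sigma=\hat\Sigma\setminus\{\varnothing\}$ otherwise. Let $\delta$ be a coboundary operator: a linear map on the complex functions on $\Sigma$ of the form $\delta\omega(\sigma)=\sum_{\tau\prec\sigma}\theta(\tau,\sigma)\omega(\tau)$, where $\theta(\tau,\sigma)=\delta1_\tau(\sigma)\in\{1,-1\}$ if $\tau\prec\sigma$ and $\delta1_\tau(\sigma)=0$ otherwise, with $\delta\delta=0$. The boundary operator is $$\partial\omega(\rho)=\frac1{m(\rho)}\sum_{\tau\succ\rho}m(\tau)\theta(\rho,\tau)\omega(\tau),\qquad\rho\in\Sigma,$$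 for all $\omega$ with $\sum_{\tau\succ\rho}m(\tau)|\omega(\tau)|<\infty$ for every $\rho\in\Sigma$; these include all $\omega\in\ell^2(\Sigma,m)$, i.e. all $\omega$ with $\sum_{\Sigma} m|\omega|^2<\infty$. For $\rho\in\Sigma$, the link $\mathrm{lk}(\rho)$ is the set of vertices $v$ such that $v\rho:=\{v\}\cup\rho$ is a simplex with $v\rho\succ\rho$. The link graph $b_\rho$ is the weighted graph on $\mathrm{lk}(\rho)$ with $b_\rho(v,v')=m(\{v,v'\}\cup\rho)$ if $v\ne v'$ and $\{v,v'\}\cup\rho\in\Sigma$, and $b_\rho(v,v')=0$ otherwise; $v,v'$ are adjacent if $b_\rho(v,v')>0$. A connected component, viewed as a weighted graph $b$ of its own, is recurrent if the Markov chain with transition probabilities $b(x,y)/\sum_z b(x,z)$, started at any vertex $x$, almost surely visits every vertex $y$ at some positive time (at an isolated vertex the chain stays put, so a component consisting of one vertex is recurrent), and transient otherwise. For a $d$-dimensional complex, property $(\mathrm T')$ says: for every $(d-1)$-dimensional simplex $\sigma\in\Sigma$ there is $\omega\in\ell^2(\Sigma,m)$, supported on the $d$-dimensional simplices, with $\partial\omega=1_\sigma$.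 **Theorem.** Let $(\Sigma,m)$ be a weighted simplicial complex with coboundary operator $\delta$. (a) If $\Sigma$ is $d$-dimensional and $(\mathrm T')$ holds, then for every $(d-2)$-dimensional simplex $\rho\in\Sigma$ that is a face of some $(d-1)$-dimensional simplex (equivalently, $\mathrm{lk}(\rho)\neq\varnothing$), the link graph $b_\rho$ has a transient connected component. (b) If a connected component of the link graph $b_\rho$ of some simplex $\rho\in\Sigma$ is transient, then for every vertex $v$ of this component there is $\omega\in\ell^2(\Sigma,m)$ such that $\partial\omega(\tau)=1_{v\rho}(\tau)$ for all $\tau\in\Sigma$ with $\tau\succ\rho$. -/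

import Mathlib

open scoped ENNReal

/-- A (weighted) graph over a discrete set `V`: a symmetric nonnegative function with vanishing
diagonal which is locally summable. -/
structure WeightedGraph (V : Type*) where
  b : V → V → ℝ
  nonneg : ∀ x y, 0 ≤ b x y
  symm : ∀ x y, b x y = b y x
  diag : ∀ x, b x x = 0
  locallySummable : ∀ x, Summable (b x)

namespace WeightedGraph

/-- The combinatorial graph underlying `b`: `x` and `y` are adjacent iff `b x y > 0`. -/
def toSimpleGraph {V : Type*} (G : WeightedGraph V) : SimpleGraph V where
  Adj x y := 0 < G.b x y
  symm := ⟨fun x y h => by rw [G.symm y x]; exact h⟩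
  loopless := ⟨fun x h => by rw [G.diag x] at h; exact lt_irrefl _ h⟩

/-- The restriction of a graph to a set of vertices. -/
def restrict {V : Type*} (G : WeightedGraph V) (s : Set V) : WeightedGraph s where
  b x y := G.b x y
  nonneg x y := G.nonneg x y
  symm x y := G.symm x y
  diag x := G.diag x
  locallySummable x := (G.locallySummable x).subtype s

open Classical in
/-- One step of the Markov chain of the graph, started at `x`: the next vertex is `y` with
probability `b x y / ∑ z, b x z`. At a vertex without neighbours, where the quotient has no
meaning, the chain stays where it is. -/
noncomputable def step {V : Type*} (G : WeightedGraph V) (x : V) : PMF V :=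
  if h : ∑' y, ENNReal.ofReal (G.b x y) = 0 then PMF.pure x
  else PMF.normalize (fun y => ENNReal.ofReal (G.b x y)) h (G.locallySummable x).tsum_ofReal_ne_top

section MarkovChain

variable {V : Type*} [MeasurableSpace V] [DiscreteMeasurableSpace V]

/-- The transition kernel of the Markov chain. -/
noncomputable def transition (G : WeightedGraph V) : ProbabilityTheory.Kernel V V where
  toFun x := (G.step x).toMeasure
  measurable' := Measurable.of_discrete

instance (G : WeightedGraph V) : ProbabilityTheory.IsMarkovKernel G.transition :=
  ⟨fun x => PMF.toMeasure.isProbabilityMeasure (G.step x)⟩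

/-- The transition kernel at time `n`, as a function of the whole past up to time `n`:
only the present position matters. -/
noncomputable def transitionAt (G : WeightedGraph V) (n : ℕ) :
    ProbabilityTheory.Kernel ((i : Finset.Iic n) → V) V :=
  G.transition.comap (fun past => past ⟨n, Finset.mem_Iic.2 le_rfl⟩) (measurable_pi_apply _)

instance (G : WeightedGraph V) (n : ℕ) : ProbabilityTheory.IsMarkovKernel (G.transitionAt n) := by
  unfold transitionAt; infer_instance

/-- The law on path space of the Markov chain `(Y n)` started at `Y 0 = x`. -/
noncomputable def chainLaw (G : WeightedGraph V) (x : V) : MeasureTheory.Measure (ℕ → V) :=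
  ProbabilityTheory.Kernel.traj (X := fun _ => V) G.transitionAt 0 (fun _ => x)

end MarkovChain

/-- A graph is recurrent if it is connected and for all `x`, `y` the Markov chain started at `x`
almost surely visits `y` at some positive time. -/
def IsRecurrent {V : Type*} (G : WeightedGraph V) : Prop :=
  letI : MeasurableSpace V := ⊤
  haveI : DiscreteMeasurableSpace V := ⟨fun _ => trivial⟩
  G.toSimpleGraph.Connected ∧ ∀ x y : V, G.chainLaw x {Y | ∃ k, 0 < k ∧ Y k = y} = 1

/-- A graph is transient if it is connected and not recurrent. -/
def IsTransient {V : Type*} (G : WeightedGraph V) : Prop :=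
  G.toSimpleGraph.Connected ∧ ¬ G.IsRecurrent

end WeightedGraph

/-- The dimension of a simplex. -/
def simplexDim {X : Type*} (σ : Finset X) : ℤ := (σ.card : ℤ) - 1

/-- `τ` is a face of `σ` (and `σ` a coface of `τ`): `τ ⊆ σ`, with exactly one element of `σ`
missing. -/
def IsFace {X : Type*} (τ σ : Finset X) : Prop := τ ⊆ σ ∧ σ.card = τ.card + 1

/-- A weighted simplicial complex. `faces` is the full complex, which contains the empty simplex;
`m` is a positive weight on it (its values off `faces` are irrelevant). Local summability is
required at every nonempty simplex; the empty simplex is treated in `simplices` below. -/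
structure WeightedComplex (X : Type*) where
  faces : Set (Finset X)
  empty_mem : ∅ ∈ faces
  down_closed : ∀ σ ∈ faces, ∀ τ ⊆ σ, τ ∈ faces
  m : Finset X → ℝ
  m_pos : ∀ σ ∈ faces, 0 < m σ
  locallySummable : ∀ τ ∈ faces, τ.Nonempty →
    Summable (fun σ : {σ : Finset X // σ ∈ faces ∧ IsFace τ σ} => m σ)

namespace WeightedComplex

variable {X : Type*}

/-- The simplices on which functions live: all faces, where the empty simplex is kept if and only
if the vertices have finite total weight. -/
def simplices (S : WeightedComplex X) : Set (Finset X) :=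
  {τ | τ ∈ S.faces ∧
    (τ = ∅ → Summable (fun σ : {σ : Finset X // σ ∈ S.faces ∧ IsFace ∅ σ} => S.m σ))}

/-- The type of simplices of the weighted complex. -/
abbrev Simplex (S : WeightedComplex X) : Type _ := {τ : Finset X // τ ∈ S.simplices}

/-- The complex has dimension `d`: `d` is the supremum of the dimensions of its simplices. -/
def HasDim (S : WeightedComplex X) (d : ℤ) : Prop := IsLUB (simplexDim '' S.faces) d

/-- Every simplex of the weighted complex has summable coface weights. -/
theorem summable_coface (S : WeightedComplex X) (τ : S.Simplex) :
    Summable (fun σ : {σ : S.Simplex // IsFace (τ : Finset X) σ} => S.m (σ : S.Simplex)) := by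
  have h : Summable
      (fun σ : {σ : Finset X // σ ∈ S.faces ∧ IsFace (τ : Finset X) σ} => S.m σ) := by
    rcases Finset.eq_empty_or_nonempty (τ : Finset X) with h0 | h0
    · have := τ.2.2 h0
      rw [h0]
      exact this
    · exact S.locallySummable _ τ.2.1 h0
  let f : {σ : S.Simplex // IsFace (τ : Finset X) σ} →
      {σ : Finset X // σ ∈ S.faces ∧ IsFace (τ : Finset X) σ} :=
    fun σ => ⟨σ.1.1, σ.1.2.1, σ.2⟩
  have hf : Function.Injective f := fun σ σ' h => by
    apply Subtype.ext
    apply Subtype.ext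
    exact congrArg (fun x => x.1) h
  exact h.comp_injective hf

/-- A simplex has finitely many faces. -/
theorem finite_face (S : WeightedComplex X) (σ : S.Simplex) :
    Finite {τ : S.Simplex // IsFace (τ : Finset X) σ} := by
  let f : {τ : S.Simplex // IsFace (τ : Finset X) σ} → (σ : Finset X).powerset :=
    fun τ => ⟨τ.1.1, Finset.mem_powerset.2 τ.2.1⟩
  refine Finite.of_injective f fun τ τ' h => ?_
  apply Subtype.ext
  apply Subtype.ext
  exact congrArg (fun x => x.1) h

/-- A coboundary operator: a linear operator `δ` on complex functions on simplices with
`δ 1_τ (σ) ∈ {1, -1, 0}`, nonzero exactly if `τ` is a face of `σ`, with `δ δ = 0`, and acting on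
arbitrary functions by the finite sum over the faces. -/
structure Coboundary [DecidableEq X] (S : WeightedComplex X) where
  δ : (S.Simplex → ℂ) →ₗ[ℂ] (S.Simplex → ℂ)
  sign : ∀ τ σ : S.Simplex,
    δ (Pi.single τ 1) σ = 1 ∨ δ (Pi.single τ 1) σ = -1 ∨ δ (Pi.single τ 1) σ = 0
  ne_zero_iff : ∀ τ σ : S.Simplex,
    δ (Pi.single τ 1) σ ≠ 0 ↔ IsFace (τ : Finset X) σ
  apply_eq_sum : ∀ (ω : S.Simplex → ℂ) (σ : S.Simplex),
    δ ω σ = ∑ᶠ τ : {τ : S.Simplex // IsFace (τ : Finset X) σ},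
      δ (Pi.single (τ : S.Simplex) 1) σ * ω τ
  comp_self : ∀ ω : S.Simplex → ℂ, δ (δ ω) = 0

/-- The incidence sign `θ(τ, σ) = δ 1_τ (σ)`. -/
def Coboundary.θ [DecidableEq X] {S : WeightedComplex X} (D : S.Coboundary) (τ σ : S.Simplex) :
    ℂ := D.δ (Pi.single τ 1) σ

/-- Membership in `ℓ²(Σ, m)`. -/
def MemL2 (S : WeightedComplex X) (ω : S.Simplex → ℂ) : Prop :=
  Summable (fun τ : S.Simplex => S.m τ * ‖ω τ‖ ^ 2)

/-- The domain of the boundary operator. -/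
def boundaryDomain (S : WeightedComplex X) : Set (S.Simplex → ℂ) :=
  {ω | ∀ ρ : S.Simplex, Summable
    (fun τ : {τ : S.Simplex // IsFace (ρ : Finset X) τ} => S.m (τ : S.Simplex) * ‖ω τ‖)}

/-- The boundary operator. It is meant on `boundaryDomain`, where the sum converges absolutely. -/
noncomputable def Coboundary.boundary [DecidableEq X] {S : WeightedComplex X} (D : S.Coboundary)
    (ω : S.Simplex → ℂ) (ρ : S.Simplex) : ℂ :=
  (1 / (S.m ρ : ℂ)) * ∑' τ : {τ : S.Simplex // IsFace (ρ : Finset X) τ},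
    (S.m (τ : S.Simplex) : ℂ) * D.θ ρ τ * ω τ

/-- Square summable functions are in the domain of the boundary operator. -/
theorem MemL2.mem_boundaryDomain {S : WeightedComplex X} {ω : S.Simplex → ℂ} (h : S.MemL2 ω) :
    ω ∈ S.boundaryDomain := by
  intro ρ
  have h1 : Summable (fun τ : {τ : S.Simplex // IsFace (ρ : Finset X) τ} =>
      S.m (τ : S.Simplex) * ‖ω τ‖ ^ 2) :=
    h.comp_injective (i := fun τ : {τ : S.Simplex // IsFace (ρ : Finset X) τ} => τ.1)
      Subtype.val_injective
  refine Summable.of_nonneg_of_le (fun τ => ?_) (fun τ => ?_) ((S.summable_coface ρ).add h1)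
  · exact mul_nonneg (S.m_pos _ τ.1.2.1).le (norm_nonneg _)
  · have hm := (S.m_pos _ τ.1.2.1).le
    nlinarith [mul_nonneg hm (sq_nonneg (‖ω τ‖ - 1)), mul_nonneg hm (sq_nonneg (‖ω τ‖))]

/-- The link of `ρ`: the vertices `v` such that `v ∪ ρ` is a coface of `ρ`. -/
def link [DecidableEq X] (S : WeightedComplex X) (ρ : S.Simplex) : Set X :=
  {v | insert v (ρ : Finset X) ∈ S.faces ∧ IsFace (ρ : Finset X) (insert v (ρ : Finset X))}

/-- The simplex `vρ = v ∪ ρ` for a vertex `v` in the link of `ρ`. -/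
def join [DecidableEq X] (S : WeightedComplex X) (ρ : S.Simplex) (v : S.link ρ) : S.Simplex :=
  ⟨insert (v : X) (ρ : Finset X), v.2.1, fun h => absurd h (Finset.insert_ne_empty _ _)⟩

open Classical in
/-- The link graph of `ρ`: the weight of `{v, v'}` is `m (vv'ρ)` if `v ≠ v'` and `vv'ρ` is
a simplex, and zero otherwise. -/
noncomputable def linkGraph [DecidableEq X] (S : WeightedComplex X) (ρ : S.Simplex) :
    WeightedGraph (S.link ρ) where
  b v v' :=
    if v ≠ v' ∧ insert (v : X) (insert (v' : X) (ρ : Finset X)) ∈ S.faces then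
      S.m (insert (v : X) (insert (v' : X) (ρ : Finset X)))
    else 0
  nonneg v v' := by
    split_ifs with h
    · exact (S.m_pos _ h.2).le
    · exact le_rfl
  symm v v' := by
    simp only [Finset.insert_comm (v : X) (v' : X), ne_comm (a := v) (b := v')]
  diag v := by simp
  locallySummable v := by
    have hnot : ∀ w : S.link ρ, (w : X) ∉ (ρ : Finset X) := fun w hw => by
      have := w.2.2.2
      rw [Finset.insert_eq_of_mem hw] at this
      omega
    let s : Set (S.link ρ) :=
      {v' | v ≠ v' ∧ insert (v : X) (insert (v' : X) (ρ : Finset X)) ∈ S.faces}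
    let τ : S.Simplex := S.join ρ v
    have hτ : (τ : Finset X) = insert (v : X) (ρ : Finset X) := rfl
    have hns : ∀ v' ∈ s, (v' : X) ∉ (τ : Finset X) := fun v' hv' hmem => by
      rw [hτ, Finset.mem_insert] at hmem
      rcases hmem with h | h
      · exact hv'.1 (Subtype.ext h.symm)
      · exact hnot v' h
    let f : s → {σ : S.Simplex // IsFace (τ : Finset X) σ} := fun v' =>
      ⟨⟨insert (v : X) (insert (v' : X) (ρ : Finset X)), v'.2.2,
        fun h => absurd h (Finset.insert_ne_empty _ _)⟩, by
        show IsFace (τ : Finset X) (insert (v : X) (insert (v' : X) (ρ : Finset X)))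
        rw [Finset.insert_comm, ← hτ]
        exact ⟨Finset.subset_insert _ _, Finset.card_insert_of_notMem (hns v' v'.2)⟩⟩
    have hf : Function.Injective f := fun a c hac => by
      have h1 : insert (a : X) (τ : Finset X) = insert (c : X) (τ : Finset X) := by
        rw [hτ, Finset.insert_comm, Finset.insert_comm (c : X)]
        exact congrArg (fun x => (x.1 : Finset X)) hac
      have h2 : (a : X) ∈ insert (c : X) (τ : Finset X) := h1 ▸ Finset.mem_insert_self _ _
      rcases Finset.mem_insert.1 h2 with h | h
      · exact Subtype.ext (Subtype.ext h)
      · exact absurd h (hns a a.2)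
    have h1 := (S.summable_coface τ).comp_injective hf
    have h2 := (summable_subtype_iff_indicator (s := s)
      (f := fun v' : S.link ρ => S.m (insert (v : X) (insert (v' : X) (ρ : Finset X))))).1 h1
    refine h2.congr fun v' => ?_
    rw [Set.indicator_apply]
    exact if_congr Iff.rfl rfl rfl

/-- The transience property (T') of a `d`-dimensional complex: for every simplex `σ` of dimension
`d - 1` there is a square summable `ω`, supported on the `d`-simplices, with `∂ω = 1_σ`. -/
def TransiencePrime [DecidableEq X] (S : WeightedComplex X) (D : S.Coboundary) (d : ℤ) : Prop :=
  ∀ σ : S.Simplex, simplexDim (σ : Finset X) = d - 1 →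
    ∃ ω : S.Simplex → ℂ, S.MemL2 ω ∧
      (∀ τ : S.Simplex, simplexDim (τ : Finset X) ≠ d → ω τ = 0) ∧
      D.boundary ω = Pi.single σ 1

end WeightedComplex

/-! ### Integration against discrete laws -/

namespace PMF

/-! Both parts reduce to Lyons' flow criterion: a connected weighted graph is transient iff it
carries a finite-energy flow with one source of nonzero strength.

The bridge to simplices is a sign rule. Evaluating `δδ1_ρ = 0` at `vv'ρ` shows that `θ(ρ,vρ)
θ(vρ,vv'ρ)` changes sign under swapping `v` and `v'` (`θ_mul_θ_antisymm`). Multiplying `ω` on the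
simplices `vv'ρ` by this sign gives an antisymmetric function on link edges, whose divergence at `v`
is `±m(vρ) ∂ω(vρ)` up to taking real parts. So a solution of `∂ω = 1_{wρ}` on the cofaces of `ρ` is
a flow from `w` (`linkFlow_isFlow`), and (a) follows for the component of any `w` in the link.
Conversely, a gradient flow with potential `h` comes from `ω = δ` of the function `vρ ↦ θ(ρ,vρ)
h(v)`, up to scaling, which gives (b).

For the criterion, let `e_n(x)` be the probability of visiting `y` by time `n`. Green's formula
bounds its energy by `2 deg(y)` times the probability of no return to `y` by time `n+1`
(`hitProb_energy`). If return is certain, the energies tend to zero and `e_n → 1` on a connected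
graph; Cauchy–Schwarz against a flow (`IsFlow.sq_le`) then forces strength zero. If not, the
gradient of `lim e_n` is the required flow (`exists_isFlow`). -/

theorem toMeasure_eq_sum_dirac {α : Type*} [MeasurableSpace α] (p : PMF α) :
    p.toMeasure = MeasureTheory.Measure.sum fun a => p a • MeasureTheory.Measure.dirac a := by
  ext s hs
  rw [p.toMeasure_apply hs, MeasureTheory.Measure.sum_apply _ hs]
  refine tsum_congr fun a => ?_
  by_cases ha : a ∈ s <;> simp [MeasureTheory.Measure.dirac_apply' _ hs, ha]

theorem lintegral_toMeasure {α : Type*} [MeasurableSpace α] (p : PMF α) {f : α → ℝ≥0∞}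
    (hf : Measurable f) : ∫⁻ a, f a ∂p.toMeasure = ∑' a, p a * f a := by
  rw [toMeasure_eq_sum_dirac, MeasureTheory.lintegral_sum_measure]
  simp [MeasureTheory.lintegral_dirac' _ hf]

end PMF

/-! ### Path measure and avoidance probabilities -/

namespace WeightedGraph

variable {V : Type*}

open Classical in
/-- One step of the chain killed when it enters `y`. -/
noncomputable def killedStep (G : WeightedGraph V) (y : V) (f : V → ℝ≥0∞) (x : V) : ℝ≥0∞ :=
  ∑' z, G.step x z * (if z = y then 0 else f z)

/-- The probability that the chain started at `x` does not visit `y` at the times `1, …, n`. -/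
noncomputable def avoidProb (G : WeightedGraph V) (y : V) (n : ℕ) (x : V) : ℝ≥0∞ :=
  (G.killedStep y)^[n] (fun _ => 1) x

-- The Markov property in operator form. Integrating out the last coordinate replaces `f` by
-- `G.killedStep y f`, so the induction needs arbitrary `f`.
open Classical MeasureTheory ProbabilityTheory in
theorem lintegral_chainLaw_avoid [MeasurableSpace V] [DiscreteMeasurableSpace V]
    (G : WeightedGraph V) (x y : V) (n : ℕ) (f : V → ℝ≥0∞) :
    ∫⁻ Y, (if ∀ k, 0 < k → k ≤ n → Y k ≠ y then f (Y n) else 0) ∂G.chainLaw x =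
      (G.killedStep y)^[n] f x := by
  induction n generalizing f with
  | zero =>
    have h : ∀ Y : ℕ → V, (if ∀ k, 0 < k → k ≤ 0 → Y k ≠ y then f (Y 0) else 0) =
        (fun p : (i : Finset.Iic 0) → V => f (p ⟨0, Finset.mem_Iic.2 le_rfl⟩))
          (Preorder.frestrictLe 0 Y) := by
      intro Y
      rw [if_pos (fun k h1 h2 => by omega)]
      rfl
    have hm : Measurable (fun p : (i : Finset.Iic 0) → V => f (p ⟨0, Finset.mem_Iic.2 le_rfl⟩)) :=
      (Measurable.of_discrete (f := f)).comp (measurable_pi_apply _)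
    simp_rw [h]
    rw [← lintegral_map hm (Preorder.measurable_frestrictLe 0), chainLaw,
      Kernel.traj_map_frestrictLe_apply, Kernel.partialTraj_self, Kernel.id_apply,
      lintegral_dirac' _ hm]
    rfl
  | succ n ih =>
    let A : Set ((i : Finset.Iic n) → V) := {p | ∀ k : Finset.Iic n, 0 < (k : ℕ) → p k ≠ y}
    have hA : MeasurableSet A := by
      have : A = ⋂ k : Finset.Iic n, {p | 0 < (k : ℕ) → p k ≠ y} := by
        ext p; simp [A]
      rw [this]
      refine MeasurableSet.iInter fun k => ?_
      have hk : Measurable fun p : (i : Finset.Iic n) → V => p k := measurable_pi_apply k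
      exact hk (MeasurableSet.of_discrete (s := {v : V | 0 < (k : ℕ) → v ≠ y}))
    let g : V → ℝ≥0∞ := fun z => if z = y then 0 else f z
    have hg : Measurable g := Measurable.of_discrete
    let H : ((i : Finset.Iic n) → V) × V → ℝ≥0∞ := fun q => if q.1 ∈ A then g q.2 else 0
    have hH : Measurable H :=
      Measurable.ite (measurable_fst hA) (hg.comp measurable_snd) measurable_const
    have hmem : ∀ Y : ℕ → V,
        Preorder.frestrictLe (π := fun _ : ℕ => V) n Y ∈ A ↔ ∀ k, 0 < k → k ≤ n → Y k ≠ y := by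
      intro Y
      constructor
      · intro h k h1 h2
        exact h ⟨k, Finset.mem_Iic.2 h2⟩ h1
      · intro h k h1
        exact h k h1 (Finset.mem_Iic.1 k.2)
    have h : ∀ Y : ℕ → V, (if ∀ k, 0 < k → k ≤ n + 1 → Y k ≠ y then f (Y (n + 1)) else 0) =
        H (Preorder.frestrictLe n Y, Y (n + 1)) := by
      intro Y
      simp only [H, g, hmem]
      by_cases h1 : ∀ k, 0 < k → k ≤ n → Y k ≠ y
      · by_cases h2 : Y (n + 1) = y
        · rw [if_neg (fun h => h (n + 1) (by omega) le_rfl h2), if_pos h1, if_pos h2]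
        · rw [if_pos, if_pos h1, if_neg h2]
          intro k hk hk'
          rcases Nat.le_succ_iff.1 hk' with h3 | h3
          · exact h1 k hk h3
          · rw [h3]; exact h2
      · rw [if_neg h1, if_neg]
        exact fun h => h1 fun k hk hk' => h k hk (by omega)
    have hmeas : Measurable fun Y : ℕ → V =>
        (Preorder.frestrictLe (π := fun _ : ℕ => V) n Y, Y (n + 1)) :=
      (Preorder.measurable_frestrictLe n).prodMk (measurable_pi_apply _)
    have hB : Measurable fun p : (i : Finset.Iic n) → V =>
        if p ∈ A then G.killedStep y f (p ⟨n, Finset.mem_Iic.2 le_rfl⟩) else 0 :=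
      Measurable.ite hA ((Measurable.of_discrete (f := G.killedStep y f)).comp
        (measurable_pi_apply _)) measurable_const
    rw [Function.iterate_succ_apply, ← ih]
    simp_rw [h]
    -- The joint law of the past up to `n` and of the next position is the law of the past composed
    -- with the transition kernel.
    rw [← lintegral_map hH hmeas, chainLaw,
      ← Kernel.partialTraj_compProd_eq_map_traj (Nat.zero_le n), Measure.lintegral_compProd hH]
    have hin : ∀ p : (i : Finset.Iic n) → V, ∫⁻ z, H (p, z) ∂G.transitionAt n p =
        if p ∈ A then G.killedStep y f (p ⟨n, Finset.mem_Iic.2 le_rfl⟩) else 0 := by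
      intro p
      by_cases hp : p ∈ A
      · simp only [H, if_pos hp]
        exact PMF.lintegral_toMeasure _ hg
      · simp [H, if_neg hp]
    simp_rw [hin]
    rw [← Kernel.traj_map_frestrictLe_apply, lintegral_map hB (Preorder.measurable_frestrictLe n)]
    simp only [hmem]
    rfl

theorem killedStep_mono (G : WeightedGraph V) (y : V) : Monotone (G.killedStep y) := by
  intro f g h x
  refine ENNReal.tsum_le_tsum fun z => ?_
  gcongr
  split_ifs
  · exact le_rfl
  · exact h z

theorem avoidProb_succ (G : WeightedGraph V) (y : V) (n : ℕ) :
    G.avoidProb y (n + 1) = G.killedStep y (G.avoidProb y n) := by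
  ext x
  exact congrFun (Function.iterate_succ_apply' _ _ _) x

theorem avoidProb_zero (G : WeightedGraph V) (y x : V) : G.avoidProb y 0 x = 1 := rfl

theorem avoidProb_succ_le (G : WeightedGraph V) (y : V) (n : ℕ) :
    G.avoidProb y (n + 1) ≤ G.avoidProb y n := by
  induction n with
  | zero =>
    intro x
    rw [avoidProb_succ, avoidProb_zero, ← (G.step x).tsum_coe]
    refine ENNReal.tsum_le_tsum fun z => ?_
    split_ifs <;> simp [avoidProb_zero]
  | succ n ih =>
    rw [avoidProb_succ G y (n + 1)]
    conv_rhs => rw [avoidProb_succ]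
    exact G.killedStep_mono y ih

theorem avoidProb_le_one (G : WeightedGraph V) (y : V) (n : ℕ) (x : V) :
    G.avoidProb y n x ≤ 1 :=
  antitone_nat_of_succ_le (G.avoidProb_succ_le y) (Nat.zero_le n) x

-- Never visiting `y` is the decreasing intersection of the events of avoiding `y` up to time `n`,
-- so continuity from above applies.
open Classical MeasureTheory ProbabilityTheory in
theorem chainLaw_hit_eq_one_iff [MeasurableSpace V] [DiscreteMeasurableSpace V]
    (G : WeightedGraph V) (x y : V) :
    G.chainLaw x {Y | ∃ k, 0 < k ∧ Y k = y} = 1 ↔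
      Filter.Tendsto (fun n => G.avoidProb y n x) Filter.atTop (nhds 0) := by
  have : IsProbabilityMeasure (G.chainLaw x) := by unfold chainLaw; infer_instance
  let B : ℕ → Set (ℕ → V) := fun n => {Y | ∀ k, 0 < k → k ≤ n → Y k ≠ y}
  have hset : ∀ k : ℕ, MeasurableSet {Y : ℕ → V | Y k = y} := fun k =>
    have hk : Measurable fun Y : ℕ → V => Y k := measurable_pi_apply k
    hk (MeasurableSet.of_discrete (s := {v : V | v = y}))
  have hS : MeasurableSet {Y : ℕ → V | ∃ k, 0 < k ∧ Y k = y} := by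
    have : {Y : ℕ → V | ∃ k, 0 < k ∧ Y k = y} = ⋃ k, ⋃ _ : 0 < k, {Y | Y k = y} := by
      ext Y; simp
    rw [this]
    exact MeasurableSet.iUnion fun k => MeasurableSet.iUnion fun _ => hset k
  have hB : ∀ n, MeasurableSet (B n) := fun n => by
    have : B n = ⋂ k, ⋂ _ : 0 < k, ⋂ _ : k ≤ n, {Y | Y k = y}ᶜ := by
      ext Y; simp [B]
    rw [this]
    exact MeasurableSet.iInter fun k => MeasurableSet.iInter fun _ =>
      MeasurableSet.iInter fun _ => (hset k).compl
  have hq : ∀ n, G.chainLaw x (B n) = G.avoidProb y n x := fun n => by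
    rw [avoidProb, ← G.lintegral_chainLaw_avoid x y n, ← lintegral_indicator_one (hB n)]
    refine lintegral_congr fun Y => ?_
    simp only [Set.indicator_apply, B, Set.mem_ofPred_eq, Pi.one_apply]
  have hanti : Antitone B := fun a b hab Y hY k h1 h2 => hY k h1 (h2.trans hab)
  have hlim := tendsto_measure_iInter_atTop (μ := G.chainLaw x)
    (fun n => (hB n).nullMeasurableSet) hanti ⟨0, measure_ne_top _ _⟩
  have hInter : ⋂ n, B n = {Y : ℕ → V | ∃ k, 0 < k ∧ Y k = y}ᶜ := by
    ext Y
    simp only [B, Set.mem_iInter, Set.mem_ofPred_eq, Set.mem_compl_iff, not_exists, not_and]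
    exact ⟨fun h k hk => h k k hk le_rfl, fun h n k hk _ => h k hk⟩
  rw [hInter] at hlim
  simp only [Function.comp_def, hq] at hlim
  rw [← prob_compl_eq_zero_iff hS]
  constructor
  · intro h
    rwa [h] at hlim
  · exact fun h => tendsto_nhds_unique hlim h

end WeightedGraph

/-! ### Energy of hitting probabilities -/

namespace WeightedGraph

variable {V : Type*}

open Filter Topology

theorem hasSum_of_eq {ι E : Type*} [AddCommMonoid E] [TopologicalSpace E] {f g : ι → E} {a b : E}
    (h : HasSum f a) (hfg : ∀ i, g i = f i) (hab : b = a) : HasSum g b := by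
  rw [funext hfg, hab]
  exact h

/-- The total weight of the edges at `x`. -/
noncomputable def deg (G : WeightedGraph V) (x : V) : ℝ := ∑' z, G.b x z

theorem deg_nonneg (G : WeightedGraph V) (x : V) : 0 ≤ G.deg x := tsum_nonneg (G.nonneg x)

theorem hasSum_deg (G : WeightedGraph V) (x : V) : HasSum (G.b x) (G.deg x) :=
  (G.locallySummable x).hasSum

/-- At an isolated vertex both sides vanish, so the convention that the chain stays there does no
harm. -/
theorem deg_mul_step (G : WeightedGraph V) (x z : V) :
    G.deg x * (G.step x z).toReal = G.b x z := by
  have hd : ∑' y, ENNReal.ofReal (G.b x y) = ENNReal.ofReal (G.deg x) :=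
    (ENNReal.ofReal_tsum_of_nonneg (G.nonneg x) (G.locallySummable x)).symm
  by_cases h : ∑' y, ENNReal.ofReal (G.b x y) = 0
  · have hb : G.b x z = 0 :=
      le_antisymm (ENNReal.ofReal_eq_zero.1 (ENNReal.tsum_eq_zero.1 h z)) (G.nonneg x z)
    have h0 : G.deg x = 0 := le_antisymm (ENNReal.ofReal_eq_zero.1 (hd ▸ h)) (G.deg_nonneg x)
    rw [h0, hb, zero_mul]
  · have h0 : G.deg x ≠ 0 := fun h0 => h (by rw [hd, h0, ENNReal.ofReal_zero])
    rw [step, dif_neg h, PMF.normalize_apply, hd, ENNReal.toReal_mul, ENNReal.toReal_inv,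
      ENNReal.toReal_ofReal (G.nonneg x z), ENNReal.toReal_ofReal (G.deg_nonneg x)]
    field_simp

theorem step_eq_pure (G : WeightedGraph V) {x : V} (h : G.deg x = 0) :
    G.step x = PMF.pure x := by
  rw [step, dif_pos]
  rw [← ENNReal.ofReal_tsum_of_nonneg (G.nonneg x) (G.locallySummable x)]
  exact ENNReal.ofReal_eq_zero.2 h.le

theorem avoidProb_self_of_deg_eq_zero (G : WeightedGraph V) {x : V} (h : G.deg x = 0) (n : ℕ) :
    G.avoidProb x (n + 1) x = 0 := by
  rw [avoidProb_succ, killedStep, G.step_eq_pure h, ENNReal.tsum_eq_zero]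
  intro z
  by_cases hz : z = x <;> simp [hz]

open Classical in
/-- The probability that the chain started at `x` visits `y` at one of the times `0, …, n`. -/
noncomputable def hitProb (G : WeightedGraph V) (y : V) (n : ℕ) (x : V) : ℝ :=
  if x = y then 1 else 1 - (G.avoidProb y n x).toReal

theorem avoidProb_ne_top (G : WeightedGraph V) (y : V) (n : ℕ) (x : V) :
    G.avoidProb y n x ≠ ∞ :=
  ((G.avoidProb_le_one y n x).trans_lt ENNReal.one_lt_top).ne

theorem avoidProb_toReal_le_one (G : WeightedGraph V) (y : V) (n : ℕ) (x : V) :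
    (G.avoidProb y n x).toReal ≤ 1 := by
  simpa using ENNReal.toReal_mono ENNReal.one_ne_top (G.avoidProb_le_one y n x)

theorem hitProb_self (G : WeightedGraph V) (y : V) (n : ℕ) : G.hitProb y n y = 1 := if_pos rfl

theorem hitProb_of_ne (G : WeightedGraph V) {x y : V} (h : x ≠ y) (n : ℕ) :
    G.hitProb y n x = 1 - (G.avoidProb y n x).toReal := if_neg h

theorem hitProb_nonneg (G : WeightedGraph V) (y : V) (n : ℕ) (x : V) : 0 ≤ G.hitProb y n x := by
  unfold hitProb
  split_ifs
  · exact zero_le_one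
  · linarith [G.avoidProb_toReal_le_one y n x]

theorem hitProb_le_one (G : WeightedGraph V) (y : V) (n : ℕ) (x : V) : G.hitProb y n x ≤ 1 := by
  unfold hitProb
  split_ifs
  · exact le_rfl
  · linarith [ENNReal.toReal_nonneg (a := G.avoidProb y n x)]

theorem avoidProb_toReal_antitone (G : WeightedGraph V) (y x : V) :
    Antitone fun n => (G.avoidProb y n x).toReal := fun _ _ h =>
  ENNReal.toReal_mono (G.avoidProb_ne_top _ _ _)
    (antitone_nat_of_succ_le (G.avoidProb_succ_le y) h x)

theorem hitProb_mono (G : WeightedGraph V) (y x : V) : Monotone fun n => G.hitProb y n x := by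
  intro m n h
  by_cases hx : x = y
  · simp [hitProb, hx]
  · simp only [hitProb, if_neg hx]
    linarith [G.avoidProb_toReal_antitone y x h]

/-- First-step analysis. The right side uses `avoidProb`, which counts positive times only, so that
the case `x = y` records the return probability. -/
theorem hasSum_mul_hitProb (G : WeightedGraph V) (x y : V) (n : ℕ) :
    HasSum (fun z => G.b x z * G.hitProb y n z)
      (G.deg x * (1 - (G.avoidProb y (n + 1) x).toReal)) := by
  classical
  have h1 : HasSum (fun z => (G.step x z).toReal) 1 := by
    have h := ENNReal.hasSum_toReal (f := fun z => G.step x z) (by simp)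
    rwa [← ENNReal.tsum_toReal_eq (fun z => (G.step x).apply_ne_top z), PMF.tsum_coe,
      ENNReal.toReal_one] at h
  have h2 : HasSum (fun z => (G.step x z * (if z = y then 0 else G.avoidProb y n z)).toReal)
      (G.avoidProb y (n + 1) x).toReal := by
    have h := G.avoidProb_ne_top y (n + 1) x
    rw [avoidProb_succ, killedStep] at h ⊢
    rw [ENNReal.tsum_toReal_eq (fun z => ENNReal.ne_top_of_tsum_ne_top h z)]
    exact (ENNReal.summable_toReal h).hasSum
  refine hasSum_of_eq ((h1.sub h2).mul_left (G.deg x)) (fun z => ?_) rfl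
  rw [ENNReal.toReal_mul, ← G.deg_mul_step x z]
  unfold hitProb
  split_ifs
  · simp
  · ring

theorem hasSum_mul_hitProb_of_ne (G : WeightedGraph V) {x y : V} (h : x ≠ y) (n : ℕ) :
    HasSum (fun z => G.b x z * G.hitProb y n z) (G.deg x * G.hitProb y (n + 1) x) := by
  exact hasSum_of_eq (G.hasSum_mul_hitProb x y n) (fun _ => rfl) (by rw [G.hitProb_of_ne h])

theorem summable_edge_of_summable (G : WeightedGraph V) {e : V → ℝ} (he : ∀ x, 0 ≤ e x)
    (hs : Summable fun x => G.deg x * e x) :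
    Summable fun p : V × V => G.b p.1 p.2 * e p.1 := by
  rw [summable_prod_of_nonneg fun p => mul_nonneg (G.nonneg _ _) (he _)]
  have hx : ∀ x, HasSum (fun z => G.b x z * e x) (G.deg x * e x) := fun x =>
    (G.hasSum_deg x).mul_right (e x)
  exact ⟨fun x => (hx x).summable, hs.congr fun x => (hx x).tsum_eq.symm⟩

/-- The degrees need not be summable, which is why finite times `n` are used. At time `0` the
function is the indicator of `y`; each step moves mass along edges, and symmetry of `b` keeps the
total finite. -/
theorem summable_deg_mul_hitProb (G : WeightedGraph V) (y : V) (n : ℕ) :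
    Summable fun x => G.deg x * G.hitProb y n x := by
  classical
  induction n with
  | zero =>
    refine summable_of_ne_finset_zero (s := {y}) fun x hx => ?_
    rw [G.hitProb_of_ne (by simpa using hx), avoidProb_zero]
    simp
  | succ n ih =>
    have h1 := (G.summable_edge_of_summable (G.hitProb_nonneg y n) ih).prod_symm.prod
    have h2 : Summable (Pi.single y (G.deg y) : V → ℝ) :=
      (hasSum_pi_single y (G.deg y)).summable
    refine Summable.of_nonneg_of_le
      (fun x => mul_nonneg (G.deg_nonneg x) (G.hitProb_nonneg y _ x)) (fun x => ?_) (h1.add h2)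
    have h3 : ∑' z, G.b z x * G.hitProb y n z = ∑' z, G.b x z * G.hitProb y n z :=
      tsum_congr fun z => by rw [G.symm]
    have h4 : 0 ≤ ∑' z, G.b z x * G.hitProb y n z :=
      tsum_nonneg fun z => mul_nonneg (G.nonneg _ _) (G.hitProb_nonneg _ _ _)
    by_cases hx : x = y
    · subst hx
      simpa [hitProb_self] using h4
    · simp only [Prod.swap_prod_mk, Pi.single_eq_of_ne hx, add_zero]
      rw [h3, (G.hasSum_mul_hitProb_of_ne hx n).tsum_eq]

/-- Green's formula: the energy density is `b e(x) (e(x) - e(z))` plus its image under exchanging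
`x` and `z`. Weighted summability of `e` justifies summing by rows. -/
theorem hasSum_edge_energy (G : WeightedGraph V) {e L : V → ℝ} (h0 : ∀ x, 0 ≤ e x)
    (h1 : ∀ x, e x ≤ 1) (hs : Summable fun x => G.deg x * e x)
    (hL : ∀ x, HasSum (fun z => G.b x z * e z) (L x)) :
    Summable (fun x => e x * (G.deg x * e x - L x)) ∧
      HasSum (fun p : V × V => G.b p.1 p.2 * (e p.1 - e p.2) ^ 2)
      (2 * ∑' x, e x * (G.deg x * e x - L x)) := by
  have hK : Summable fun p : V × V => G.b p.1 p.2 * e p.1 * (e p.1 - e p.2) := by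
    refine Summable.of_norm_bounded (G.summable_edge_of_summable h0 hs) fun p => ?_
    have hp := mul_nonneg (G.nonneg p.1 p.2) (h0 p.1)
    rw [Real.norm_eq_abs, abs_mul, abs_of_nonneg hp]
    refine mul_le_of_le_one_right hp (abs_le.2 ⟨?_, ?_⟩) <;>
      linarith [h0 p.1, h0 p.2, h1 p.1, h1 p.2]
  have hin : ∀ x, HasSum (fun z => G.b x z * e x * (e x - e z))
      (e x * (G.deg x * e x - L x)) := fun x => by
    exact hasSum_of_eq ((((G.hasSum_deg x).mul_right (e x)).sub (hL x)).mul_left (e x))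
      (fun z => by ring) rfl
  have h2 := hK.hasSum.prod_fiberwise hin
  have h3 : HasSum (fun p : V × V => G.b p.1 p.2 * e p.1 * (e p.1 - e p.2))
      (∑' x, e x * (G.deg x * e x - L x)) := h2.tsum_eq ▸ hK.hasSum
  refine ⟨h2.summable, ?_⟩
  have h4 := (Equiv.prodComm V V).hasSum_iff.2 h3
  refine hasSum_of_eq (h3.add h4) (fun p => ?_) (two_mul _)
  · simp only [Function.comp, Equiv.prodComm_apply, Prod.fst_swap, Prod.snd_swap, G.symm p.2 p.1]
    ring

/-- Away from `y` the Laplacian of `hitProb` is `deg(x) (e_n(x) - e_{n+1}(x)) ≤ 0`, so in Green's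
formula only the term at `y` can contribute positively. -/
theorem hitProb_energy (G : WeightedGraph V) (y : V) (n : ℕ) :
    Summable (fun p : V × V => G.b p.1 p.2 * (G.hitProb y n p.1 - G.hitProb y n p.2) ^ 2) ∧
      ∑' p : V × V, G.b p.1 p.2 * (G.hitProb y n p.1 - G.hitProb y n p.2) ^ 2 ≤
        2 * (G.deg y * (G.avoidProb y (n + 1) y).toReal) := by
  classical
  obtain ⟨h1, h2⟩ := G.hasSum_edge_energy (G.hitProb_nonneg y n) (G.hitProb_le_one y n)
    (G.summable_deg_mul_hitProb y n) (fun x => G.hasSum_mul_hitProb x y n)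
  refine ⟨h2.summable, ?_⟩
  rw [h2.tsum_eq]
  have h3 := hasSum_pi_single y (G.deg y * (G.avoidProb y (n + 1) y).toReal)
  rw [← h3.tsum_eq]
  gcongr 2 * ?_
  refine h1.tsum_le_tsum (fun x => ?_) h3.summable
  by_cases hx : x = y
  · subst hx
    simp [hitProb_self]
    linarith
  · rw [Pi.single_eq_of_ne hx, ← G.hitProb_of_ne hx, ← mul_sub]
    refine mul_nonpos_of_nonneg_of_nonpos (G.hitProb_nonneg _ _ _)
      (mul_nonpos_of_nonneg_of_nonpos (G.deg_nonneg x) ?_)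
    linarith [G.hitProb_mono y x (Nat.le_succ n)]

/-! ### Flows and the transience criterion -/

open Classical in
/-- `F` is a flow of finite energy with source `w` of strength `c`. -/
structure IsFlow (G : WeightedGraph V) (w : V) (c : ℝ) (F : V → V → ℝ) : Prop where
  antisymm : ∀ x z, F x z = -F z x
  energy : Summable fun p : V × V => G.b p.1 p.2 * F p.1 p.2 ^ 2
  div : ∀ x, HasSum (fun z => G.b x z * F x z) (if x = w then c else 0)

/-- Summation by parts pairs the gradient of `e` with the flow to give `2 c e(w)`; the rest is
Cauchy–Schwarz. -/
theorem IsFlow.sq_le {G : WeightedGraph V} {w : V} {c : ℝ} {F : V → V → ℝ} (hF : G.IsFlow w c F)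
    {e : V → ℝ} (h0 : ∀ x, 0 ≤ e x) (h1 : ∀ x, e x ≤ 1) (hs : Summable fun x => G.deg x * e x)
    (hE : Summable fun p : V × V => G.b p.1 p.2 * (e p.1 - e p.2) ^ 2) :
    (2 * c * e w) ^ 2 ≤ (∑' p : V × V, G.b p.1 p.2 * (e p.1 - e p.2) ^ 2) *
      ∑' p : V × V, G.b p.1 p.2 * F p.1 p.2 ^ 2 := by
  classical
  have hK : Summable fun p : V × V => G.b p.1 p.2 * e p.1 * F p.1 p.2 := by
    refine Summable.of_norm_bounded ((G.summable_edge_of_summable h0 hs).add hF.energy) fun p => ?_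
    have hb := G.nonneg p.1 p.2
    rw [Real.norm_eq_abs, abs_le]
    have h3 : 0 ≤ e p.1 := h0 p.1
    have h4 : e p.1 ≤ 1 := h1 p.1
    -- Young's inequality together with `e² ≤ e`; this makes the pairing absolutely summable.
    have key : |e p.1 * F p.1 p.2| ≤ e p.1 + F p.1 p.2 ^ 2 := by
      rw [abs_le]
      constructor <;> nlinarith [sq_nonneg (F p.1 p.2 + e p.1), sq_nonneg (F p.1 p.2 - e p.1)]
    rw [abs_le] at key
    constructor <;> nlinarith
  have hin : ∀ x, HasSum (fun z => G.b x z * e x * F x z)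
      ((Pi.single w (c * e w) : V → ℝ) x) := fun x => by
    refine hasSum_of_eq ((hF.div x).mul_left (e x)) (fun z => by ring) ?_
    by_cases hx : x = w
    · subst hx; simp [mul_comm]
    · simp [hx]
  have h3 : HasSum (fun p : V × V => G.b p.1 p.2 * e p.1 * F p.1 p.2) (c * e w) := by
    have := (hK.hasSum.prod_fiberwise hin).unique (hasSum_pi_single w (c * e w))
    exact this ▸ hK.hasSum
  have h4 := (Equiv.prodComm V V).hasSum_iff.2 h3
  have h5 : HasSum (fun p : V × V => G.b p.1 p.2 * ((e p.1 - e p.2) * F p.1 p.2))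
      (2 * c * e w) := by
    refine hasSum_of_eq (h3.add h4) (fun p => ?_) (by ring)
    simp only [Function.comp, Equiv.prodComm_apply, Prod.fst_swap, Prod.snd_swap,
      G.symm p.2 p.1, hF.antisymm p.2 p.1]
    ring
  -- Cauchy–Schwarz as nonnegativity in `t` of the energy of `t ∇e + F`.
  have h6 : discrim (∑' p : V × V, G.b p.1 p.2 * (e p.1 - e p.2) ^ 2) (2 * (2 * c * e w))
      (∑' p : V × V, G.b p.1 p.2 * F p.1 p.2 ^ 2) ≤ 0 := by
    refine discrim_le_zero fun t => ?_
    have := ((hE.hasSum.mul_right (t * t)).add (h5.mul_right (2 * t))).add hF.energy.hasSum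
    have hle := this.nonneg fun p => by
      have : 0 ≤ G.b p.1 p.2 * ((e p.1 - e p.2) * t + F p.1 p.2) ^ 2 :=
        mul_nonneg (G.nonneg _ _) (sq_nonneg _)
      linarith
    linarith
  unfold discrim at h6
  linarith

theorem hitProb_energy_tendsto (G : WeightedGraph V) {v : V}
    (hv : Tendsto (fun n => (G.avoidProb v n v).toReal) atTop (𝓝 0)) :
    Tendsto (fun n => ∑' p : V × V, G.b p.1 p.2 *
      (G.hitProb v n p.1 - G.hitProb v n p.2) ^ 2) atTop (𝓝 0) := by
  refine squeeze_zero
    (fun n => tsum_nonneg fun p => mul_nonneg (G.nonneg _ _) (sq_nonneg _))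
    (fun n => (G.hitProb_energy v n).2) ?_
  have := ((tendsto_add_atTop_iff_nat 1).2 hv).const_mul (G.deg v)
  simpa using this.const_mul 2

/-- A single edge term is at most the whole energy, so differences across edges tend to zero; follow
a walk to `v`. -/
theorem hitProb_tendsto_one (G : WeightedGraph V) (hG : G.toSimpleGraph.Connected) {v : V}
    (hv : Tendsto (fun n => (G.avoidProb v n v).toReal) atTop (𝓝 0)) (x : V) :
    Tendsto (fun n => G.hitProb v n x) atTop (𝓝 1) := by
  obtain ⟨p⟩ := hG.preconnected x v
  induction p with
  | nil => simp [hitProb_self]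
  | @cons a b c hab _ ih =>
    have hb : 0 < G.b a b := hab
    have h1 : Tendsto (fun n => G.b a b * (G.hitProb c n a - G.hitProb c n b) ^ 2) atTop (𝓝 0) :=
      squeeze_zero (fun n => mul_nonneg hb.le (sq_nonneg _))
        (fun n => (G.hitProb_energy c n).1.le_tsum (a, b)
          fun p _ => mul_nonneg (G.nonneg _ _) (sq_nonneg _)) (G.hitProb_energy_tendsto hv)
    have h2 : Tendsto (fun n => (G.hitProb c n a - G.hitProb c n b) ^ 2) atTop (𝓝 0) := by
      have := h1.const_mul (G.b a b)⁻¹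
      simpa [← mul_assoc, inv_mul_cancel₀ hb.ne'] using this
    have h3 : Tendsto (fun n => G.hitProb c n a - G.hitProb c n b) atTop (𝓝 0) := by
      rw [tendsto_zero_iff_abs_tendsto_zero]
      have := (Real.continuous_sqrt.tendsto 0).comp h2
      simpa [Function.comp_def, Real.sqrt_sq_eq_abs] using this
    simpa using h3.add (ih hv)

/-- The vertex `v` need not be the source `w`. This is what transfers non-return from one vertex to
all others. -/
theorem IsFlow.not_tendsto {G : WeightedGraph V} (hG : G.toSimpleGraph.Connected) {w : V} {c : ℝ}
    {F : V → V → ℝ} (hF : G.IsFlow w c F) (hc : c ≠ 0) (v : V) :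
    ¬ Tendsto (fun n => (G.avoidProb v n v).toReal) atTop (𝓝 0) := by
  intro hv
  have h1 : Tendsto (fun n => (2 * c * G.hitProb v n w) ^ 2) atTop (𝓝 ((2 * c * 1) ^ 2)) :=
    ((G.hitProb_tendsto_one hG hv w).const_mul _).pow 2
  have h2 := (G.hitProb_energy_tendsto hv).mul_const (∑' p : V × V, G.b p.1 p.2 * F p.1 p.2 ^ 2)
  have h3 := le_of_tendsto_of_tendsto' h1 h2 fun n =>
    hF.sq_le (G.hitProb_nonneg v n) (G.hitProb_le_one v n) (G.summable_deg_mul_hitProb v n)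
      (G.hitProb_energy v n).1
  have h4 : 0 < (2 * c * 1) ^ 2 := by positivity
  linarith

/-- The limit `h` of the hitting probabilities is harmonic off `y`, and its divergence at `y` is the
degree times the escape probability `s`. -/
theorem exists_isFlow (G : WeightedGraph V) {y : V}
    (hy : ¬ Tendsto (fun n => (G.avoidProb y n y).toReal) atTop (𝓝 0)) :
    ∃ (c : ℝ) (h : V → ℝ), c ≠ 0 ∧ G.IsFlow y c fun x z => h x - h z := by
  classical
  let h : V → ℝ := fun x => ⨆ n, G.hitProb y n x
  have hh : ∀ x, Tendsto (fun n => G.hitProb y n x) atTop (𝓝 (h x)) := fun x =>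
    tendsto_atTop_ciSup (G.hitProb_mono y x) ⟨1, by rintro _ ⟨n, rfl⟩; exact G.hitProb_le_one y n x⟩
  let s : ℝ := ⨅ n, (G.avoidProb y n y).toReal
  have hs : Tendsto (fun n => (G.avoidProb y n y).toReal) atTop (𝓝 s) :=
    tendsto_atTop_ciInf (G.avoidProb_toReal_antitone y y)
      ⟨0, by rintro _ ⟨n, rfl⟩; exact ENNReal.toReal_nonneg⟩
  have hs0 : s ≠ 0 := fun h0 => hy (h0 ▸ hs)
  -- At an isolated vertex the chain is back at time `1`.
  have hd : G.deg y ≠ 0 := fun h0 => hy <| by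
    rw [← tendsto_add_atTop_iff_nat 1]
    simp [G.avoidProb_self_of_deg_eq_zero h0]
  have hy1 : h y = 1 := tendsto_nhds_unique (hh y) (by simp [hitProb_self])
  have hh0 : ∀ x, 0 ≤ h x := fun x => ge_of_tendsto' (hh x) fun n => G.hitProb_nonneg y n x
  have hh1 : ∀ x, h x ≤ 1 := fun x => le_of_tendsto' (hh x) fun n => G.hitProb_le_one y n x
  have hlim : ∀ x, Tendsto (fun n => ∑' z, G.b x z * G.hitProb y n z) atTop
      (𝓝 (∑' z, G.b x z * h z)) := fun x =>
    tendsto_tsum_of_dominated_convergence (G.locallySummable x)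
      (fun z => (hh z).const_mul _) (Eventually.of_forall fun n z => by
        rw [Real.norm_eq_abs, abs_of_nonneg (mul_nonneg (G.nonneg _ _) (G.hitProb_nonneg _ _ _))]
        exact mul_le_of_le_one_right (G.nonneg _ _) (G.hitProb_le_one _ _ _))
  have hsum : ∀ x, Summable fun z => G.b x z * h z := fun x =>
    Summable.of_nonneg_of_le (fun z => mul_nonneg (G.nonneg _ _) (hh0 z))
      (fun z => mul_le_of_le_one_right (G.nonneg _ _) (hh1 z)) (G.locallySummable x)
  have hval : ∀ x, ∑' z, G.b x z * h z =
      G.deg x * h x - if x = y then G.deg y * s else 0 := fun x => by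
    refine tendsto_nhds_unique (hlim x) ?_
    by_cases hx : x = y
    · subst hx
      simp_rw [fun n => (G.hasSum_mul_hitProb x x n).tsum_eq]
      simp only [if_true, hy1, ← mul_sub]
      exact (((tendsto_add_atTop_iff_nat 1).2 hs).const_sub 1).const_mul _
    · simp_rw [fun n => (G.hasSum_mul_hitProb_of_ne hx n).tsum_eq]
      rw [if_neg hx, sub_zero]
      exact ((tendsto_add_atTop_iff_nat 1).2 (hh x)).const_mul _
  refine ⟨G.deg y * s, h, mul_ne_zero hd hs0, fun x z => by ring, ?_, fun x => ?_⟩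
  · refine summable_of_sum_le (c := 2 * G.deg y)
      (fun p => mul_nonneg (G.nonneg _ _) (sq_nonneg _)) fun u => ?_
    -- Fatou by hand: finite partial sums pass to the limit under the uniform energy bound.
    have hu : Tendsto (fun n => ∑ p ∈ u, G.b p.1 p.2 *
        (G.hitProb y n p.1 - G.hitProb y n p.2) ^ 2) atTop
        (𝓝 (∑ p ∈ u, G.b p.1 p.2 * (h p.1 - h p.2) ^ 2)) :=
      tendsto_finsetSum _ fun p _ => (((hh p.1).sub (hh p.2)).pow 2).const_mul _
    refine le_of_tendsto' hu fun n => ?_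
    obtain ⟨h1, h2⟩ := G.hitProb_energy y n
    refine (h1.sum_le_tsum u fun p _ => mul_nonneg (G.nonneg _ _) (sq_nonneg _)).trans
      (h2.trans ?_)
    gcongr
    exact mul_le_of_le_one_right (G.deg_nonneg y) (G.avoidProb_toReal_le_one _ _ _)
  · have h1 := ((G.hasSum_deg x).mul_right (h x)).sub (hsum x).hasSum
    rw [hval x] at h1
    exact hasSum_of_eq h1 (fun z => by ring) (by ring)

theorem isRecurrent_iff (G : WeightedGraph V) :
    G.IsRecurrent ↔ G.toSimpleGraph.Connected ∧
      ∀ x y, Tendsto (fun n => (G.avoidProb y n x).toReal) atTop (𝓝 0) := by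
  let _ : MeasurableSpace V := ⊤
  have : DiscreteMeasurableSpace V := ⟨fun _ => trivial⟩
  refine and_congr Iff.rfl (forall_congr' fun x => forall_congr' fun y => ?_)
  rw [G.chainLaw_hit_eq_one_iff x y]
  rw [← ENNReal.tendsto_toReal_iff (fun n => G.avoidProb_ne_top y n x) ENNReal.zero_ne_top]
  rfl

/-- A connected graph with a nonzero flow of finite energy is transient. -/
theorem IsFlow.isTransient {G : WeightedGraph V} (hG : G.toSimpleGraph.Connected) {w : V} {c : ℝ}
    {F : V → V → ℝ} (hF : G.IsFlow w c F) (hc : c ≠ 0) : G.IsTransient :=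
  ⟨hG, fun h => hF.not_tendsto hG hc w ((G.isRecurrent_iff.1 h).2 w w)⟩

/-- A transient graph has a gradient flow of finite energy with source at any given vertex. -/
theorem IsTransient.exists_isFlow {G : WeightedGraph V} (hG : G.IsTransient) (v : V) :
    ∃ (c : ℝ) (h : V → ℝ), c ≠ 0 ∧ G.IsFlow v c fun x z => h x - h z := by
  refine G.exists_isFlow fun hv => hG.2 (G.isRecurrent_iff.2 ⟨hG.1, fun x y => ?_⟩)
  -- If return to `y` were not certain, a flow out of `y` would contradict the certain return to
  -- `v`.
  have hy : Tendsto (fun n => (G.avoidProb y n y).toReal) atTop (𝓝 0) := by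
    by_contra hy
    obtain ⟨c, h, hc, hF⟩ := G.exists_isFlow hy
    exact hF.not_tendsto hG.1 hc v hv
  by_cases hx : x = y
  · rwa [hx]
  · have := G.hitProb_tendsto_one hG.1 hy x
    simp_rw [G.hitProb_of_ne hx] at this
    simpa using this.const_sub 1

end WeightedGraph

/-! ### Flows and connected components -/

namespace WeightedGraph

variable {V : Type*}

theorem connected_restrict_supp (G : WeightedGraph V) (C : G.toSimpleGraph.ConnectedComponent) :
    (G.restrict C.supp).toSimpleGraph.Connected :=
  C.connected_toSimpleGraph

theorem b_eq_zero_of_mem_of_notMem (G : WeightedGraph V) {C : G.toSimpleGraph.ConnectedComponent}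
    {x z : V} (hx : x ∈ C.supp) (hz : z ∉ C.supp) : G.b x z = 0 := by
  by_contra h
  exact hz (C.mem_supp_of_adj_mem_supp hx (lt_of_le_of_ne (G.nonneg x z) (Ne.symm h)))

open Classical in
theorem IsFlow.restrict {G : WeightedGraph V} {w : V} {c : ℝ} {F : V → V → ℝ}
    (hF : G.IsFlow w c F) (C : G.toSimpleGraph.ConnectedComponent) (hw : w ∈ C.supp) :
    (G.restrict C.supp).IsFlow ⟨w, hw⟩ c fun x z => F x z where
  antisymm x z := hF.antisymm x z
  energy := hF.energy.comp_injective
    (i := Prod.map (Subtype.val : C.supp → V) (Subtype.val : C.supp → V))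
    (Subtype.val_injective.prodMap Subtype.val_injective)
  div x := by
    have h := (Subtype.val_injective (p := fun z => z ∈ C.supp)).hasSum_iff
      (f := fun z => G.b x z * F x z) (a := if (x : V) = w then c else 0) fun z hz => by
        rw [G.b_eq_zero_of_mem_of_notMem x.2 (by simpa using hz), zero_mul]
    have h2 := h.2 (hF.div x)
    refine hasSum_of_eq h2 (fun _ => rfl) ?_
    by_cases hx : (x : V) = w
    · rw [if_pos hx, if_pos (Subtype.ext hx)]
    · rw [if_neg hx, if_neg fun h => hx (congrArg Subtype.val h)]

-- The gradient of the potential extended by zero may be nonzero across the boundary of the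
-- component, but `b` vanishes there.
open Classical in
theorem IsFlow.extend {G : WeightedGraph V} {C : G.toSimpleGraph.ConnectedComponent}
    {w : C.supp} {c : ℝ} {h : C.supp → ℝ}
    (hF : (G.restrict C.supp).IsFlow w c fun x z => h x - h z) :
    G.IsFlow w c fun x z => (if hx : x ∈ C.supp then h ⟨x, hx⟩ else 0) -
      (if hz : z ∈ C.supp then h ⟨z, hz⟩ else 0) where
  antisymm x z := by ring
  energy := by
    refine ((Subtype.val_injective.prodMap Subtype.val_injective).summable_iff
      (g := Prod.map (Subtype.val : C.supp → V) (Subtype.val : C.supp → V)) ?_).1 ?_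
    · rintro ⟨x, z⟩ hxz
      by_cases hx : x ∈ C.supp
      · have hz : z ∉ C.supp := fun hz => hxz ⟨(⟨x, hx⟩, ⟨z, hz⟩), rfl⟩
        simp [G.b_eq_zero_of_mem_of_notMem hx hz]
      · by_cases hz : z ∈ C.supp
        · simp [G.symm x z, G.b_eq_zero_of_mem_of_notMem hz hx]
        · simp [hx, hz]
    · refine hF.energy.congr fun p => ?_
      simp only [Function.comp, Prod.map_fst, Prod.map_snd, Subtype.coe_prop, dite_true]
      rfl
  div x := by
    by_cases hx : x ∈ C.supp
    · refine ((Subtype.val_injective (p := fun z => z ∈ C.supp)).hasSum_iff fun z hz => ?_).1 ?_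
      · rw [G.b_eq_zero_of_mem_of_notMem hx (by simpa using hz), zero_mul]
      · refine hasSum_of_eq (hF.div ⟨x, hx⟩) (fun z => ?_) ?_
        · simp only [Function.comp, hx, z.2, dite_true]
          rfl
        · simp [Subtype.ext_iff]
    · refine hasSum_of_eq hasSum_zero (fun z => ?_) (if_neg fun hxw : x = w => hx (hxw ▸ w.2))
      by_cases hz : z ∈ C.supp
      · simp [G.symm x z, G.b_eq_zero_of_mem_of_notMem hz hx]
      · simp [hx, hz]

end WeightedGraph

/-! ### Combinatorics of links -/

namespace WeightedComplex

variable {X : Type*} [DecidableEq X] {S : WeightedComplex X} {ρ : S.Simplex}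

/-- Adjacency in the link graph. -/
def LinkAdj (S : WeightedComplex X) (ρ : S.Simplex) (v v' : S.link ρ) : Prop :=
  v ≠ v' ∧ insert (v : X) (insert (v' : X) (ρ : Finset X)) ∈ S.faces

/-- The simplex over an edge of the link graph. -/
def linkEdge {v v' : S.link ρ} (h : S.LinkAdj ρ v v') : S.Simplex :=
  ⟨insert (v : X) (insert (v' : X) (ρ : Finset X)), h.2,
    fun h => absurd h (Finset.insert_ne_empty _ _)⟩

theorem LinkAdj.symm {v v' : S.link ρ} (h : S.LinkAdj ρ v v') : S.LinkAdj ρ v' v :=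
  ⟨h.1.symm, by rw [Finset.insert_comm]; exact h.2⟩

theorem linkEdge_symm {v v' : S.link ρ} (h : S.LinkAdj ρ v v') :
    linkEdge h.symm = linkEdge h :=
  Subtype.ext (Finset.insert_comm _ _ _)

theorem notMem_of_link (v : S.link ρ) : (v : X) ∉ (ρ : Finset X) := fun hv => by
  have := v.2.2.2
  rw [Finset.insert_eq_of_mem hv] at this
  omega

theorem linkGraph_b_of_adj {v v' : S.link ρ} (h : S.LinkAdj ρ v v') :
    (S.linkGraph ρ).b v v' = S.m (linkEdge h) := if_pos h

theorem linkGraph_b_of_not_adj {v v' : S.link ρ} (h : ¬ S.LinkAdj ρ v v') :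
    (S.linkGraph ρ).b v v' = 0 := if_neg h

theorem isFace_join (v : S.link ρ) : IsFace (ρ : Finset X) (S.join ρ v : S.Simplex) := v.2.2

theorem isFace_linkEdge_right {v v' : S.link ρ} (h : S.LinkAdj ρ v v') :
    IsFace (S.join ρ v' : Finset X) (linkEdge h) := by
  refine ⟨Finset.subset_insert _ _, Finset.card_insert_of_notMem fun hm => ?_⟩
  rcases Finset.mem_insert.1 hm with h1 | h1
  · exact h.1 (Subtype.ext h1)
  · exact notMem_of_link v h1

theorem isFace_linkEdge_left {v v' : S.link ρ} (h : S.LinkAdj ρ v v') :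
    IsFace (S.join ρ v : Finset X) (linkEdge h) := by
  rw [← linkEdge_symm]
  exact isFace_linkEdge_right h.symm

theorem _root_.IsFace.exists_insert {τ σ : Finset X} (h : IsFace τ σ) :
    ∃ u, u ∉ τ ∧ insert u τ = σ := by
  have h1 : (σ \ τ).card = 1 := by
    rw [Finset.card_sdiff_of_subset h.1, h.2]
    omega
  obtain ⟨u, hu⟩ := Finset.card_eq_one.1 h1
  have hu' : u ∈ σ \ τ := hu ▸ Finset.mem_singleton_self u
  refine ⟨u, (Finset.mem_sdiff.1 hu').2, ?_⟩
  rw [Finset.insert_eq, ← hu, Finset.sdiff_union_of_subset h.1]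

theorem exists_eq_join {τ : S.Simplex} (h : IsFace (ρ : Finset X) τ) :
    ∃ v : S.link ρ, S.join ρ v = τ := by
  obtain ⟨u, _, hu⟩ := h.exists_insert
  exact ⟨⟨u, by rw [link, Set.mem_ofPred_eq, hu]; exact ⟨τ.2.1, h⟩⟩, Subtype.ext hu⟩

theorem join_injective : Function.Injective (S.join ρ) := fun v v' h => by
  have h1 : (v : X) ∈ (S.join ρ v' : Finset X) := h ▸ Finset.mem_insert_self _ _
  rcases Finset.mem_insert.1 h1 with h2 | h2
  · exact Subtype.ext h2
  · exact absurd h2 (notMem_of_link v)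

theorem exists_eq_linkEdge {v : S.link ρ} {τ : S.Simplex}
    (h : IsFace (S.join ρ v : Finset X) τ) :
    ∃ (v' : S.link ρ) (h : S.LinkAdj ρ v v'), linkEdge h = τ := by
  obtain ⟨u, hu, hτ⟩ := h.exists_insert
  have hu' : u ≠ v ∧ u ∉ (ρ : Finset X) := by
    simpa [join] using hu
  have heq : insert (v : X) (insert u (ρ : Finset X)) = τ := by
    rw [Finset.insert_comm]
    exact hτ
  let v' : S.link ρ := ⟨u, S.down_closed _ τ.2.1 _ (heq ▸ Finset.subset_insert _ _),
    Finset.subset_insert _ _, Finset.card_insert_of_notMem hu'.2⟩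
  have hadj : S.LinkAdj ρ v v' :=
    ⟨fun h => hu'.1 (congrArg Subtype.val h).symm, by rw [heq]; exact τ.2.1⟩
  exact ⟨v', hadj, Subtype.ext heq⟩

theorem eq_or_eq_of_mem_linkEdge {u v v' : S.link ρ} (h : S.LinkAdj ρ v v')
    (hu : (u : X) ∈ (linkEdge h : Finset X)) : u = v ∨ u = v' := by
  rcases Finset.mem_insert.1 hu with h1 | h1
  · exact Or.inl (Subtype.ext h1)
  · rcases Finset.mem_insert.1 h1 with h1 | h1
    · exact Or.inr (Subtype.ext h1)
    · exact absurd h1 (notMem_of_link u)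

/-- The ends of an edge are the two vertices of its simplex outside `ρ`; only their order is lost.
-/
theorem linkEdge_inj {v v' w w' : S.link ρ} (h : S.LinkAdj ρ v v') (h' : S.LinkAdj ρ w w')
    (heq : linkEdge h = linkEdge h') : v = w ∧ v' = w' ∨ v = w' ∧ v' = w := by
  have h1 := eq_or_eq_of_mem_linkEdge h' (u := v)
    (heq ▸ Finset.mem_insert_self _ _)
  have h2 := eq_or_eq_of_mem_linkEdge h' (u := v')
    (heq ▸ Finset.mem_insert_of_mem (Finset.mem_insert_self _ _))
  have h3 := h.1
  rcases h1 with rfl | rfl <;> rcases h2 with rfl | rfl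
  · exact absurd rfl h3
  · exact Or.inl ⟨rfl, rfl⟩
  · exact Or.inr ⟨rfl, rfl⟩
  · exact absurd rfl h3

open Classical in
/-- The cofaces of `vρ` correspond to the neighbours of `v` in the link graph. -/
theorem hasSum_coface_join_iff {E : Type*} [AddCommMonoid E] [TopologicalSpace E] {v : S.link ρ}
    {k : S.Simplex → E} {a : E} :
    HasSum (fun τ : {τ : S.Simplex // IsFace (S.join ρ v : Finset X) τ} => k τ) a ↔
      HasSum (fun v' => if h : S.LinkAdj ρ v v' then k (linkEdge h) else 0) a := by
  let i : {v' // S.LinkAdj ρ v v'} → {τ : S.Simplex // IsFace (S.join ρ v : Finset X) τ} :=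
    fun v' => ⟨linkEdge v'.2, isFace_linkEdge_left v'.2⟩
  have hi : Function.Bijective i := by
    constructor
    · intro a b hab
      rcases linkEdge_inj a.2 b.2 (congrArg Subtype.val hab) with h | h
      · exact Subtype.ext h.2
      · exact absurd h.1 b.2.1
    · rintro ⟨τ, hτ⟩
      obtain ⟨v', h, rfl⟩ := exists_eq_linkEdge hτ
      exact ⟨⟨v', h⟩, rfl⟩
  rw [← (Equiv.ofBijective i hi).hasSum_iff,
    ← (Subtype.val_injective (p := fun v' => S.LinkAdj ρ v v')).hasSum_iff]
  · refine iff_of_eq (congrArg (fun f => HasSum f a) (funext fun v' => ?_))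
    simp [i, v'.2]
  · intro v' hv'
    rw [dif_neg (by simpa using hv')]

/-! ### Incidence signs -/

namespace Coboundary

variable (D : S.Coboundary)

theorem θ_mul_self {τ σ : S.Simplex} (h : IsFace (τ : Finset X) σ) : D.θ τ σ * D.θ τ σ = 1 := by
  have h0 := (D.ne_zero_iff τ σ).2 h
  rcases D.sign τ σ with h1 | h1 | h1
  · simp [θ, h1]
  · simp [θ, h1]
  · exact absurd h1 h0

theorem norm_θ {τ σ : S.Simplex} (h : IsFace (τ : Finset X) σ) : ‖D.θ τ σ‖ = 1 := by
  have := congrArg norm (D.θ_mul_self h)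
  rw [norm_mul, norm_one] at this
  nlinarith [norm_nonneg (D.θ τ σ)]

theorem θ_eq_zero {τ σ : S.Simplex} (h : ¬ IsFace (τ : Finset X) σ) : D.θ τ σ = 0 :=
  not_not.1 (mt (D.ne_zero_iff τ σ).1 h)

/-- Among the faces of `vv'ρ`, only `vρ` and `v'ρ` contain `ρ`. -/
theorem δ_linkEdge {ω : S.Simplex → ℂ}
    (hω : ∀ τ : S.Simplex, ¬ IsFace (ρ : Finset X) τ → ω τ = 0) {v v' : S.link ρ}
    (h : S.LinkAdj ρ v v') :
    D.δ ω (linkEdge h) = D.θ (S.join ρ v) (linkEdge h) * ω (S.join ρ v) +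
      D.θ (S.join ρ v') (linkEdge h) * ω (S.join ρ v') := by
  classical
  let a : {τ : S.Simplex // IsFace (τ : Finset X) (linkEdge h)} :=
    ⟨S.join ρ v, isFace_linkEdge_left h⟩
  let b : {τ : S.Simplex // IsFace (τ : Finset X) (linkEdge h)} :=
    ⟨S.join ρ v', isFace_linkEdge_right h⟩
  have hab : a ≠ b := fun hab => h.1 (join_injective (congrArg Subtype.val hab))
  rw [D.apply_eq_sum, finsum_eq_sum_of_support_subset (s := {a, b}), Finset.sum_pair hab]
  · rfl
  · intro τ hτ
    have hρ : IsFace (ρ : Finset X) τ.1 := by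
      by_contra hρ
      exact hτ (by simp [hω _ hρ])
    obtain ⟨u, hu⟩ := exists_eq_join hρ
    have hu' : (u : X) ∈ (linkEdge h : Finset X) :=
      τ.2.1 (hu ▸ Finset.mem_insert_self _ _)
    rw [Finset.coe_pair]
    rcases eq_or_eq_of_mem_linkEdge h hu' with rfl | rfl
    · exact Or.inl (Subtype.ext hu.symm)
    · exact Or.inr (Subtype.ext hu.symm)

/-- This is `δδ1_ρ = 0` read at `vv'ρ`. -/
theorem θ_mul_θ_antisymm {v v' : S.link ρ} (h : S.LinkAdj ρ v v') :
    D.θ ρ (S.join ρ v) * D.θ (S.join ρ v) (linkEdge h) =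
      -(D.θ ρ (S.join ρ v') * D.θ (S.join ρ v') (linkEdge h)) := by
  have h1 := congrFun (D.comp_self (Pi.single ρ 1)) (linkEdge h)
  rw [D.δ_linkEdge (ω := D.δ (Pi.single ρ 1)) (fun τ hτ => D.θ_eq_zero hτ) h] at h1
  have h2 : D.θ (S.join ρ v) (linkEdge h) * D.θ ρ (S.join ρ v) +
    D.θ (S.join ρ v') (linkEdge h) * D.θ ρ (S.join ρ v') = 0 := h1
  linear_combination h2

end Coboundary

/-! ### From simplicial functions to flows -/

open Classical in
/-- The flow on the link graph of `ρ` carried by a function on simplices. -/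
noncomputable def linkFlow (D : S.Coboundary) (ρ : S.Simplex) (ω : S.Simplex → ℂ)
    (v v' : S.link ρ) : ℝ :=
  if h : S.LinkAdj ρ v v' then
    (D.θ ρ (S.join ρ v) * D.θ (S.join ρ v) (linkEdge h) * ω (linkEdge h)).re
  else 0

theorem linkFlow_antisymm (D : S.Coboundary) (ω : S.Simplex → ℂ) (v v' : S.link ρ) :
    linkFlow D ρ ω v v' = -linkFlow D ρ ω v' v := by
  unfold linkFlow
  by_cases h : S.LinkAdj ρ v v'
  · rw [dif_pos h, dif_pos h.symm, linkEdge_symm h, D.θ_mul_θ_antisymm h]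
    simp
  · rw [dif_neg h, dif_neg fun h' => h h'.symm, neg_zero]

/-- A nonnegative function on simplices that is summable is summable over the edges of a link. -/
theorem summable_linkEdge {f : S.Simplex → ℝ} (hf : Summable f)
    {g : S.link ρ × S.link ρ → ℝ} (hg : ∀ p, ¬ S.LinkAdj ρ p.1 p.2 → g p = 0)
    (h0 : ∀ p, 0 ≤ g p) (hfg : ∀ v v' (h : S.LinkAdj ρ v v'), g (v, v') ≤ f (linkEdge h)) :
    Summable g := by
  classical
  -- An arbitrary order selects one orientation of each edge, on which `linkEdge` is injective.
  let _ : LinearOrder (S.link ρ) := linearOrderOfSTO WellOrderingRel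
  have key : ∀ g : S.link ρ × S.link ρ → ℝ, (∀ p, ¬ S.LinkAdj ρ p.1 p.2 → g p = 0) →
      (∀ p, 0 ≤ g p) → (∀ v v' (h : S.LinkAdj ρ v v'), g (v, v') ≤ f (linkEdge h)) →
      Summable fun p => if p.1 < p.2 then g p else 0 := by
    intro g hg h0 hfg
    let i : {p : S.link ρ × S.link ρ // S.LinkAdj ρ p.1 p.2 ∧ p.1 < p.2} → S.Simplex :=
      fun p => linkEdge p.2.1
    have hi : Function.Injective i := fun p q hpq => by
      rcases linkEdge_inj p.2.1 q.2.1 hpq with h | h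
      · exact Subtype.ext (Prod.ext h.1 h.2)
      · have h1 := p.2.2
        rw [h.1, h.2] at h1
        exact absurd h1 (lt_asymm q.2.2)
    refine (Subtype.val_injective.summable_iff
      (g := (Subtype.val : {p : S.link ρ × S.link ρ // S.LinkAdj ρ p.1 p.2 ∧ p.1 < p.2} → _))
      fun p hp => ?_).1 (Summable.of_nonneg_of_le (fun p => ?_) (fun p => ?_)
        (hf.comp_injective hi))
    · split_ifs with hlt
      · exact hg p fun h => hp ⟨⟨p, h, hlt⟩, rfl⟩
      · rfl
    · simp only [Function.comp, if_pos p.2.2]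
      exact h0 _
    · simp only [Function.comp, if_pos p.2.2]
      exact hfg _ _ p.2.1
  have h1 := key g hg h0 hfg
  have h2 := (key (fun p => g p.swap) (fun p h => hg _ fun h' => h h'.symm) (fun p => h0 _)
    (fun v v' h => linkEdge_symm h ▸ hfg v' v h.symm)).prod_symm
  refine (h1.add h2).congr fun p => ?_
  rcases lt_trichotomy p.1 p.2 with h | h | h
  · simp [h, lt_asymm h]
  · simp [h, hg p fun h' => h'.1 h]
  · simp [h, lt_asymm h]

/-- The divergence at `v` is the real part of `θ(ρ,vρ) m(vρ) ∂ω(vρ)`, whence the strength `m(wρ)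
θ(ρ,wρ)`. The energy is controlled by the `ℓ²` norm of `ω`, since signs have modulus one. -/
theorem linkFlow_isFlow (D : S.Coboundary) {ω : S.Simplex → ℂ} (hω : S.MemL2 ω) (w : S.link ρ)
    (hw : ∀ v, D.boundary ω (S.join ρ v) = (Pi.single (S.join ρ w) 1 : S.Simplex → ℂ) (S.join ρ v)) :
    ∃ c : ℝ, c ≠ 0 ∧ (S.linkGraph ρ).IsFlow w c (linkFlow D ρ ω) := by
  classical
  have hm := (S.m_pos _ (S.join ρ w).2.1).ne'
  have hre : ∀ v, ((D.θ ρ (S.join ρ v)).re : ℂ) = D.θ ρ (S.join ρ v) := fun v => by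
    rcases D.sign ρ (S.join ρ v) with h | h | h <;> simp [Coboundary.θ, h]
  have hθ : (D.θ ρ (S.join ρ w)).re ≠ 0 := fun h => by
    have := D.norm_θ (isFace_join w)
    rw [← hre, h] at this
    simp at this
  refine ⟨S.m (S.join ρ w) * (D.θ ρ (S.join ρ w)).re, mul_ne_zero hm hθ,
    linkFlow_antisymm D ω, ?_, fun v => ?_⟩
  · refine summable_linkEdge hω (fun p hp => by simp [linkGraph_b_of_not_adj hp])
      (fun p => mul_nonneg ((S.linkGraph ρ).nonneg _ _) (sq_nonneg _)) fun v v' h => ?_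
    simp only [linkFlow, dif_pos h, linkGraph_b_of_adj h]
    have := (S.m_pos _ (linkEdge h).2.1).le
    gcongr _ * ?_
    rw [← sq_abs]
    gcongr
    refine (Complex.abs_re_le_norm _).trans ?_
    rw [norm_mul, norm_mul, D.norm_θ (isFace_join v), D.norm_θ (isFace_linkEdge_left h)]
    simp
  · have hs : Summable fun τ : {τ : S.Simplex // IsFace (S.join ρ v : Finset X) τ} =>
        (S.m (τ : S.Simplex) : ℂ) * D.θ (S.join ρ v) τ * ω τ := by
      refine Summable.of_norm_bounded (hω.mem_boundaryDomain (S.join ρ v)) fun τ => ?_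
      rw [norm_mul, norm_mul, D.norm_θ τ.2, Complex.norm_real,
        Real.norm_of_nonneg (S.m_pos _ τ.1.2.1).le, mul_one]
    have hmv : (S.m (S.join ρ v) : ℂ) ≠ 0 :=
      Complex.ofReal_ne_zero.2 (S.m_pos _ (S.join ρ v).2.1).ne'
    have hval : ∑' τ : {τ : S.Simplex // IsFace (S.join ρ v : Finset X) τ},
        (S.m (τ : S.Simplex) : ℂ) * D.θ (S.join ρ v) τ * ω τ =
        if v = w then (S.m (S.join ρ w) : ℂ) else 0 := by
      have h := hw v
      rw [Coboundary.boundary, one_div, inv_mul_eq_iff_eq_mul₀ hmv] at h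
      rw [h]
      by_cases hvw : v = w
      · simp [hvw]
      · rw [if_neg hvw, Pi.single_eq_of_ne fun h => hvw (join_injective h), mul_zero]
    have h1 := hasSum_coface_join_iff
      (k := fun τ => (S.m τ : ℂ) * D.θ (S.join ρ v) τ * ω τ).1 (hval ▸ hs.hasSum)
    refine WeightedGraph.hasSum_of_eq
      (Complex.hasSum_re (h1.mul_left (D.θ ρ (S.join ρ v)))) (fun v' => ?_) ?_
    · by_cases h : S.LinkAdj ρ v v'
      · rw [linkFlow, dif_pos h, dif_pos h, linkGraph_b_of_adj h, ← Complex.re_ofReal_mul]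
        congr 1
        ring
      · simp [dif_neg h, linkGraph_b_of_not_adj h]
    · by_cases hvw : v = w
      · subst hvw
        rw [if_pos rfl, if_pos rfl, mul_comm, ← Complex.re_mul_ofReal]
      · simp [hvw]

/-! ### From potentials to simplicial functions -/

open Classical in
/-- The function on the cofaces of `ρ` given by a function on the link. -/
noncomputable def linkLift (D : S.Coboundary) (ρ : S.Simplex) (h : S.link ρ → ℂ)
    (τ : S.Simplex) : ℂ :=
  if hτ : ∃ v, S.join ρ v = τ then D.θ ρ τ * h hτ.choose else 0

theorem linkLift_join (D : S.Coboundary) (h : S.link ρ → ℂ) (v : S.link ρ) :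
    linkLift D ρ h (S.join ρ v) = D.θ ρ (S.join ρ v) * h v := by
  have hτ : ∃ u, S.join ρ u = S.join ρ v := ⟨v, rfl⟩
  rw [linkLift, dif_pos hτ, join_injective hτ.choose_spec]

theorem linkLift_eq_zero (D : S.Coboundary) (h : S.link ρ → ℂ) {τ : S.Simplex}
    (hτ : ¬ IsFace (ρ : Finset X) τ) : linkLift D ρ h τ = 0 :=
  dif_neg fun ⟨v, hv⟩ => hτ (hv ▸ isFace_join v)

/-- The signs built into `linkLift` turn the coboundary into a signed graph gradient. -/
theorem δ_linkLift (D : S.Coboundary) (h : S.link ρ → ℂ) {v v' : S.link ρ}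
    (hv : S.LinkAdj ρ v v') :
    D.δ (linkLift D ρ h) (linkEdge hv) =
      D.θ ρ (S.join ρ v) * D.θ (S.join ρ v) (linkEdge hv) * (h v - h v') := by
  rw [D.δ_linkEdge (fun τ => linkLift_eq_zero D h) hv, linkLift_join, linkLift_join]
  linear_combination h v' * D.θ_mul_θ_antisymm hv

theorem δ_linkLift_eq_zero (D : S.Coboundary) (h : S.link ρ → ℂ) {τ : S.Simplex}
    (hτ : ∀ v v' (hv : S.LinkAdj ρ v v'), linkEdge hv ≠ τ) : D.δ (linkLift D ρ h) τ = 0 := by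
  rw [D.apply_eq_sum]
  refine finsum_eq_zero_of_forall_eq_zero fun σ => ?_
  rw [linkLift_eq_zero, mul_zero]
  intro hσ
  obtain ⟨v, hv⟩ := exists_eq_join hσ
  have h2 := σ.2
  rw [← hv] at h2
  obtain ⟨v', hv', h3⟩ := exists_eq_linkEdge h2
  exact hτ v v' hv' h3

theorem memL2_δ_linkLift (D : S.Coboundary) (h : S.link ρ → ℂ)
    (hs : Summable fun p : S.link ρ × S.link ρ =>
      (S.linkGraph ρ).b p.1 p.2 * ‖h p.1 - h p.2‖ ^ 2) :
    S.MemL2 (D.δ (linkLift D ρ h)) := by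
  let R : Set S.Simplex :=
    {τ | ∃ p : S.link ρ × S.link ρ, ∃ hp : S.LinkAdj ρ p.1 p.2, linkEdge hp = τ}
  -- Either orientation of the edge will do, as the energy density is symmetric.
  let sec : R → S.link ρ × S.link ρ := fun τ => τ.2.choose
  have hsec : ∀ τ : R, ∃ hp : S.LinkAdj ρ (sec τ).1 (sec τ).2, linkEdge hp = τ.1 :=
    fun τ => τ.2.choose_spec
  have hinj : Function.Injective sec := fun τ τ' hττ' => by
    obtain ⟨h1, h1'⟩ := hsec τ
    obtain ⟨h2, h2'⟩ := hsec τ'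
    refine Subtype.ext ?_
    rw [← h1', ← h2']
    refine Subtype.ext ?_
    simp only [linkEdge, hττ']
  refine (Subtype.val_injective (p := fun τ => τ ∈ R).summable_iff fun τ hτ => ?_).1
    ((hs.comp_injective hinj).congr fun τ => ?_)
  · rw [δ_linkLift_eq_zero]
    · simp
    · rintro v v' hv rfl
      exact hτ ⟨⟨_, (v, v'), hv, rfl⟩, rfl⟩
  · obtain ⟨h1, h1'⟩ := hsec τ
    simp only [Function.comp]
    rw [← h1', δ_linkLift, norm_mul, norm_mul, D.norm_θ (isFace_join _),
      D.norm_θ (isFace_linkEdge_left h1), linkGraph_b_of_adj h1, one_mul, one_mul]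

/-- The sign `θ(uρ,·)` occurs twice and squares to one, leaving the graph Laplacian of `h` at `u`.
-/
theorem boundary_δ_linkLift (D : S.Coboundary) (h : S.link ρ → ℂ) {u : S.link ρ} {a : ℂ}
    (ha : HasSum (fun v => ((S.linkGraph ρ).b u v : ℂ) * (h u - h v)) a) :
    D.boundary (D.δ (linkLift D ρ h)) (S.join ρ u) =
      1 / (S.m (S.join ρ u) : ℂ) * (D.θ ρ (S.join ρ u) * a) := by
  classical
  rw [Coboundary.boundary]
  congr 1
  refine HasSum.tsum_eq (hasSum_coface_join_iff
    (k := fun τ => (S.m τ : ℂ) * D.θ (S.join ρ u) τ * D.δ (linkLift D ρ h) τ).2 ?_)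
  refine WeightedGraph.hasSum_of_eq (ha.mul_left (D.θ ρ (S.join ρ u))) (fun v => ?_) rfl
  by_cases hv : S.LinkAdj ρ u v
  · rw [dif_pos hv, δ_linkLift, linkGraph_b_of_adj hv]
    linear_combination (S.m (linkEdge hv) : ℂ) * D.θ ρ (S.join ρ u) * (h u - h v) *
      D.θ_mul_self (isFace_linkEdge_left hv)
  · rw [dif_neg hv, linkGraph_b_of_not_adj hv]
    simp

end WeightedComplex

/-! ### Conclusion -/

theorem mainTheorem5 {X : Type*} [DecidableEq X] (S : WeightedComplex X) (D : S.Coboundary) :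
    (∀ d : ℤ, S.HasDim d → S.TransiencePrime D d →
      ∀ ρ : S.Simplex, simplexDim (ρ : Finset X) = d - 2 →
        (∃ σ : S.Simplex, IsFace (ρ : Finset X) σ) →
        ∃ C : (S.linkGraph ρ).toSimpleGraph.ConnectedComponent,
          ((S.linkGraph ρ).restrict C.supp).IsTransient) ∧
    (∀ (ρ : S.Simplex) (C : (S.linkGraph ρ).toSimpleGraph.ConnectedComponent),
      ((S.linkGraph ρ).restrict C.supp).IsTransient →
        ∀ v ∈ C.supp, ∃ ω : S.Simplex → ℂ, S.MemL2 ω ∧ ω ∈ S.boundaryDomain ∧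
          ∀ τ : S.Simplex, IsFace (ρ : Finset X) τ →
            D.boundary ω τ = (Pi.single (S.join ρ v) 1 : S.Simplex → ℂ) τ) := by
  classical
  refine ⟨fun d _ hT ρ hρ ⟨σ, hσ⟩ => ?_, fun ρ C hC v hv => ?_⟩
  · obtain ⟨w, rfl⟩ := WeightedComplex.exists_eq_join hσ
    have hdim : simplexDim (S.join ρ w : Finset X) = d - 1 := by
      have := hσ.2
      unfold simplexDim at hρ ⊢
      omega
    obtain ⟨ω, hω, -, hb⟩ := hT _ hdim
    obtain ⟨c, hc, hF⟩ := WeightedComplex.linkFlow_isFlow D hω w fun v => congrFun hb _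
    let C := (S.linkGraph ρ).toSimpleGraph.connectedComponentMk w
    exact ⟨C, (hF.restrict C rfl).isTransient (WeightedGraph.connected_restrict_supp _ C) hc⟩
  · obtain ⟨c, h, hc, hF⟩ := hC.exists_isFlow ⟨v, hv⟩
    have hF' := hF.extend
    set g : S.link ρ → ℝ := fun x => if hx : x ∈ C.supp then h ⟨x, hx⟩ else 0
    have hθ := D.θ_mul_self (WeightedComplex.isFace_join v)
    have hmv : (S.m (S.join ρ v) : ℂ) ≠ 0 :=
      Complex.ofReal_ne_zero.2 (S.m_pos _ (S.join ρ v).2.1).ne'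
    have hc' : (c : ℂ) ≠ 0 := Complex.ofReal_ne_zero.2 hc
    -- Normalised so that the boundary at `vρ`, which is `θ k c / m(vρ)`, equals `θ² = 1`.
    let k : ℂ := S.m (S.join ρ v) * D.θ ρ (S.join ρ v) / c
    have hL2 : S.MemL2 (D.δ (WeightedComplex.linkLift D ρ fun x => k * g x)) := by
      refine WeightedComplex.memL2_δ_linkLift D _ ((hF'.energy.mul_left (‖k‖ ^ 2)).congr fun p => ?_)
      rw [← mul_sub, norm_mul, ← Complex.ofReal_sub, Complex.norm_real, mul_pow, Real.norm_eq_abs,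
        sq_abs]
      ring
    refine ⟨_, hL2, hL2.mem_boundaryDomain, fun τ hτ => ?_⟩
    obtain ⟨u, rfl⟩ := WeightedComplex.exists_eq_join hτ
    have hu := ((Complex.hasSum_ofReal.2 (hF'.div u)).mul_left k)
    rw [WeightedComplex.boundary_δ_linkLift D (u := u)
      (a := k * ((if u = v then c else 0 : ℝ) : ℂ))]
    · by_cases huv : u = v
      · subst huv
        rw [Pi.single_eq_same, if_pos rfl]
        simp only [k]
        field_simp
        linear_combination hθ
      · rw [if_neg huv, Pi.single_eq_of_ne fun h => huv (WeightedComplex.join_injective h)]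
        simp
    · refine WeightedGraph.hasSum_of_eq hu (fun z => ?_) (by by_cases huv : u = v <;> simp [huv])
      rw [Complex.ofReal_mul, Complex.ofReal_sub]
      ring
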